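/- Let $V$ be a finite-dimensional smooth manifold (Hausdorff, $\sigma$-compact, possibly with boundary or corners). For an integer $k\ge 0$ let $C^k(V)$ be the space of $k$ times continuously differentiable functions $V\to\mathbb R$ with the $C^k$ topology, that is, the topology of uniform convergence, on compact subsets of charts, of all partial derivatives of order $\le k$; let $C^\infty(V)=\bigcap_k C^k(V)$. A subset $C$ of a linear topological space is called $\infty$-convex if for every bounded sequence $(x_i)_{i\ge 0}$ in $C$ and all reals $t_i\ge 0$ with $\sum_i t_i=1$ the series $\sum_i t_i x_i$ converges to a point of $C$. A $Z$-set in a metrizable space $X$ is a closed subset $B\subset X$ such that every continuous map from the Hilbert cube to $X$ can be uniformly approximated by continuous maps whose range misses $B$; a $\sigma Z$-subset of $X$ is a countable union of $Z$-sets in $X$. A pair $(Y,X)$ of spaces with $X\subset Y$ is called $(\mathcal M_0,\mathcal M_2)$-preuniversal if for every compact metrizable space $K$ and every $F_{\sigma\delta}$-set $M\subset K$ there is a continuous map $f:K\to Y$ with $f^{-1}(X)=M$. **Theorem.** Let $l\ge 0$ be an integer and let $C^l_\bullet$ be an $\infty$-convex $G_\delta$ subset of $C^l(V)$. For $\gamma\in\{l,l+1,\dots\}\cup\{\infty\}$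 set $C^\gamma_\bullet=C^l_\bullet\cap C^\gamma(V)$, where for finite $\gamma$ the set $C^\gamma_\bullet$ carries the subspace topology from $C^\gamma(V)$. Suppose that $C^\infty_\bullet$ is nonempty. If $n\ge l$ is an integer such that for every integer $k\ge n$ the subset $C^\infty_\bullet$ is dense in $C^k_\bullet$, and $C^{k+1}_\bullet$ is contained in a $\sigma Z$-subset of the space $C^k_\bullet$, then the pair $(C^n_\bullet,C^\infty_\bullet)$ is $(\mathcal M_0,\mathcal M_2)$-preuniversal. -/

import Mathlib

open scoped Manifold ContDiff Topology

universe u v w u₀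

section FunctionSpaces

variable {E : Type u} [NormedAddCommGroup E] [NormedSpace ℝ E]
  {H : Type v} [TopologicalSpace H] (I : ModelWithCorners ℝ E H)
  (V : Type w) [TopologicalSpace V] [ChartedSpace H V]

/-- `C^k(V)`: the real vector space of `k` times continuously differentiable real functions on the
manifold `V`, for an integer `k ≥ 0`. -/
abbrev CkFun (k : ℕ) := C^(k : ℕ)⟮I, V; ℝ⟯

variable {I V}

theorem continuousOn_chartDeriv [IsManifold I ∞ V] {k : ℕ} (f : CkFun I V k) (x : V)
    {j : ℕ} (hj : j ≤ k) :
    ContinuousOn (iteratedFDerivWithin ℝ j (f ∘ (extChartAt I x).symm) (extChartAt I x).target)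
      (extChartAt I x).target := by
  have h : ContDiffOn ℝ (k : ℕ) (f ∘ (extChartAt I x).symm) (extChartAt I x).target :=
    contMDiffOn_iff_contDiffOn.1
      (f.contMDiff.comp_contMDiffOn (contMDiffOn_extChartAt_symm (n := (k : ℕ)) x))
  exact h.continuousOn_iteratedFDerivWithin (by exact_mod_cast hj)
    (uniqueDiffOn_extChartAt_target x)

/-- The `j`-th derivative (`j ≤ k`) of `f ∈ C^k(V)` written in the chart around `x`, as a continuous
function on the image of the chart. -/
noncomputable def chartDeriv [IsManifold I ∞ V] {k : ℕ} (f : CkFun I V k) (x : V)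
    (j : Fin (k + 1)) : C((extChartAt I x).target, E [×(j : ℕ)]→L[ℝ] ℝ) where
  toFun y := iteratedFDerivWithin ℝ (j : ℕ) (f ∘ (extChartAt I x).symm)
    (extChartAt I x).target y
  continuous_toFun := continuousOn_iff_continuous_domRestrict.1
    (continuousOn_chartDeriv f x (Nat.lt_succ_iff.1 j.2))

/-- The `C^k` topology on `C^k(V)`: uniform convergence, on compact subsets of charts, of all
derivatives of order `≤ k`.  It is the coarsest topology for which all the maps `f ↦ chartDeriv f x j`
are continuous, where spaces of continuous functions carry the compact-open topology; equivalently
it is given by the seminorms `f ↦ max_{j ≤ k} max_{y ∈ D} ‖D^j (f ∘ φ_x⁻¹) y‖`, `D` running over the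
compact subsets of the image of the chart `φ_x`. -/
noncomputable instance CkFun.instTopologicalSpace [IsManifold I ∞ V] (k : ℕ) :
    TopologicalSpace (CkFun I V k) :=
  TopologicalSpace.induced
    (fun (f : CkFun I V k) (x : V) (j : Fin (k + 1)) => chartDeriv f x j) inferInstance

/-- For `S ⊆ C^l(V)` and `k ≥ l`, the subset `S ∩ C^k(V)` of `C^k(V)`. With the subtype
topology it is a subspace of `C^k(V)` with its `C^k` topology. -/
def bulletSet {l : ℕ} (S : Set (CkFun I V l)) (k : ℕ) : Set (CkFun I V k) :=
  {g | ∃ f ∈ S, (f : V → ℝ) = g}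

/-- `S ∩ C^r(V)` as a subset of the space `S ∩ C^k(V)`, for `S ⊆ C^l(V)` and `l ≤ k ≤ r ≤ ∞`. -/
def regularPart {l : ℕ} (S : Set (CkFun I V l)) (k : ℕ) (r : ℕ∞) : Set (bulletSet S k) :=
  {g | ContMDiff I 𝓘(ℝ, ℝ) r (g : CkFun I V k)}

end FunctionSpaces

/-- A subset `C` of a linear topological space is `∞`-convex if for every bounded sequence `x` in
`C` and nonnegative reals `t i` with sum `1`, the series `∑ t i • x i` converges to a point of `C`. -/
def IsInftyConvex {L : Type*} [AddCommGroup L] [Module ℝ L] [TopologicalSpace L]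
    (C : Set L) : Prop :=
  ∀ x : ℕ → L, (∀ i, x i ∈ C) → Bornology.IsVonNBounded ℝ (Set.range x) →
    ∀ t : ℕ → ℝ, (∀ i, 0 ≤ t i) → HasSum t 1 →
      ∃ y ∈ C, Filter.Tendsto (fun m => ∑ i ∈ Finset.range m, t i • x i) Filter.atTop (𝓝 y)

/-- The Hilbert cube. -/
abbrev HilbertCube := ℕ → unitInterval

/-- A `Z`-set in a metrizable space `X`: a closed set `B` such that every continuous map from the
Hilbert cube to `X` is a uniform limit of continuous maps with range missing `B`. (The compact-open
topology on `C(HilbertCube, X)` is that of uniform convergence for any metric inducing the topology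
of `X`, as the Hilbert cube is compact.) -/
def IsZSet {X : Type*} [TopologicalSpace X] (B : Set X) : Prop :=
  IsClosed B ∧ Dense {g : C(HilbertCube, X) | ∀ q, g q ∉ B}

/-- A `σZ`-set: a countable union of `Z`-sets. -/
def IsSigmaZSet {X : Type*} [TopologicalSpace X] (Y : Set X) : Prop :=
  ∃ Z : ℕ → Set X, (∀ i, IsZSet (Z i)) ∧ Y = ⋃ i, Z i

/-- An `F_σδ`-set: a countable intersection of countable unions of closed sets. -/
def IsFSigmaDelta {X : Type*} [TopologicalSpace X] (M : Set X) : Prop :=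
  ∃ F : ℕ → ℕ → Set X, (∀ i j, IsClosed (F i j)) ∧ M = ⋂ i, ⋃ j, F i j

/-- A pair `(Y, X)` with `X ⊆ Y` is `(M_0, M_2)`-preuniversal if for every compact metrizable space
`K` and every `F_σδ`-set `M` in `K` there is a continuous map `f : K → Y` with `f ⁻¹ (X) = M`. -/
def IsM0M2Preuniversal.{a, b} (Y : Type a) [TopologicalSpace Y] (X : Set Y) : Prop :=
  ∀ (K : Type b) [TopologicalSpace K] [CompactSpace K] [TopologicalSpace.MetrizableSpace K]
    (M : Set K), IsFSigmaDelta M → ∃ f : C(K, Y), f ⁻¹' X = M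

open Set Filter TopologicalSpace
open scoped Pointwise

/-! ### Bump functions adapted to an `F_σ`-set -/

/-! After embedding `K` in the Hilbert cube, write M as an intersection of F_σ-sets M_i.

For each level k = n + i there is a continuous map φ_i from the cube to C^k_• that is smooth-valued
on M_i and never takes a C^(k+1) function off M_i (`exists_continuousMap_contMDiff_iff`). It is a
limit of maps into the dense convex set C^∞_•. Each correction pushes the values off finitely many
of the Z-sets covering C^(k+1)_•, and acts only where a bump function is nonzero. A point of M_i
meets finitely many nonzero bumps, so its value freezes inside C^∞_•. A point off M_i meets bumps
equal to 1 infinitely often, so its limit misses every Z-set. Nested small balls preserve what has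
been gained, and the G_δ hypothesis keeps the limit in C^k_•.

The levels are then combined (`exists_continuousMap_preimage_eq_iInter`) as f = a + ∑ 2^(-i-1) s_i
(φ_i - a), with a smooth and s_i in (0, 1] so small that each tail starting at i converges in
C^(n+i). If x lies in all M_i, then f(x) is a smooth finite sum plus a C^(n+i) tail for every i,
hence smooth. If i is least with x outside M_i, the earlier terms are smooth and the later tail is
C^(n+i+1), but the i-th term is not, so f(x) is not smooth. Finally f(x) = ∑ 2^(-i-1) ((1 - s_i) a +
s_i φ_i(x)), and ∞-convexity puts it in S.

The limits require C^k(V) to be a completely metrizable locally convex space; this is proved from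
its jets in charts. -/

theorem exists_bump_sequence {Q : Type*} [TopologicalSpace Q] [PerfectlyNormalSpace Q]
    (F : ℕ → Set Q) (hF : ∀ i, IsClosed (F i)) :
    ∃ b : ℕ → C(Q, ℝ), (∀ s x, b s x ∈ Icc (0 : ℝ) 1) ∧
      (∀ x ∈ ⋃ i, F i, ∀ᶠ s in atTop, b s x = 0) ∧
      (∀ x ∉ ⋃ i, F i, ∃ᶠ s in atTop, b s x = 1) := by
  have hB (i : ℕ) : IsClosed (⋃ j ∈ Iic i, F j) :=
    (finite_Iic i).isClosed_biUnion fun j _ => hF j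
  choose δ hδ hδ1 using fun i =>
    perfectlyNormalSpace_iff_forall_isClosed_preimage_zero.1 ‹_› _ (hB i)
  have hδ0 (i : ℕ) (x : Q) : δ i x = 0 ↔ ∃ j ≤ i, x ∈ F j := by
    have : x ∈ (⋃ j ∈ Iic i, F j) ↔ x ∈ δ i ⁻¹' {0} := by rw [← hδ i]
    simpa using this.symm
  -- The index s codes a pair (i, m). The bump is nonzero only where 0 < m δ_i < 2 and equals 1
  -- where |m δ_i - 1| ≤ 1/2. It vanishes on F_0, …, F_i, so a point of F_{i₀} can only meet nonzero
  -- bumps with i < i₀, and finitely many m for each.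
  let b : ℕ → C(Q, ℝ) := fun s =>
    ⟨fun x => max 0 (min 1 (2 - 2 * |(s.unpair.2 : ℝ) * δ s.unpair.1 x - 1|)), by fun_prop⟩
  have hb (s : ℕ) (x : Q) :
      b s x = max 0 (min 1 (2 - 2 * |(s.unpair.2 : ℝ) * δ s.unpair.1 x - 1|)) := rfl
  refine ⟨b, fun s x => ⟨le_max_left _ _, max_le zero_le_one (min_le_left _ _)⟩, ?_, ?_⟩
  · intro x hx
    obtain ⟨i₀, hi₀⟩ := mem_iUnion.1 hx
    have hfin (i : ℕ) : ∃ N : ℕ, ∀ m ≥ N, max 0 (min 1 (2 - 2 * |(m : ℝ) * δ i x - 1|)) = 0 := by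
      rcases eq_or_lt_of_le (hδ1 i x).1 with h | h
      · exact ⟨0, fun m _ => by simp [← h]⟩
      · obtain ⟨N, hN⟩ := exists_nat_ge (2 / δ i x)
        refine ⟨N, fun m hm => max_eq_left (min_le_of_right_le ?_)⟩
        have h1 : 2 ≤ (m : ℝ) * δ i x := by
          rw [← div_le_iff₀ h]
          exact hN.trans (by exact_mod_cast hm)
        have := le_abs_self ((m : ℝ) * δ i x - 1)
        linarith
    choose N hN using hfin
    have hsub : {s | b s x ≠ 0} ⊆
        ⋃ i ∈ Iio i₀, ⋃ m ∈ Iio (N i), {Nat.pair i m} := by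
      intro s hs
      have h1 : s.unpair.1 < i₀ := by
        by_contra! h
        exact hs (by simp [hb, (hδ0 _ x).2 ⟨i₀, h, hi₀⟩])
      have h2 : s.unpair.2 < N s.unpair.1 := by
        by_contra! h
        exact hs (hN _ _ h)
      simp only [mem_iUnion, mem_singleton_iff]
      exact ⟨_, h1, _, h2, (Nat.pair_unpair s).symm⟩
    have hfinite : {s | b s x ≠ 0}.Finite :=
      ((finite_Iio i₀).biUnion fun i _ =>
        (finite_Iio (N i)).biUnion fun m _ => finite_singleton _).subset hsub
    have := hfinite.compl_mem_cofinite
    rw [Nat.cofinite_eq_atTop] at this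
    filter_upwards [this] with s hs
    simpa using hs
  · intro x hx
    have hpos (i : ℕ) : 0 < δ i x := by
      refine lt_of_le_of_ne (hδ1 i x).1 fun h => hx ?_
      obtain ⟨j, -, hj⟩ := (hδ0 i x).1 h.symm
      exact mem_iUnion_of_mem j hj
    rw [frequently_atTop]
    intro i
    -- With m = ⌊1/δ⌋ the product m δ is at most 1, exceeds 1 - δ and is at least δ, hence lies in
    -- [1/2, 1].
    refine ⟨Nat.pair i ⌊1 / δ i x⌋₊, Nat.left_le_pair _ _, ?_⟩
    have ht := hpos i
    have ht1 := (hδ1 i x).2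
    have hfl : (⌊1 / δ i x⌋₊ : ℝ) * δ i x ≤ 1 := by
      rw [← le_div_iff₀ ht]
      exact Nat.floor_le (by positivity)
    have hlt : 1 < (⌊1 / δ i x⌋₊ : ℝ) * δ i x + δ i x := by
      have := Nat.lt_floor_add_one (1 / δ i x)
      rw [div_lt_iff₀ ht] at this
      linarith
    have hone : δ i x ≤ (⌊1 / δ i x⌋₊ : ℝ) * δ i x := by
      have : (1 : ℝ) ≤ ⌊1 / δ i x⌋₊ := by
        exact_mod_cast Nat.le_floor (by rw [Nat.cast_one, le_div_iff₀ ht]; linarith)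
      nlinarith
    simp only [hb, Nat.unpair_pair]
    have habs : |(⌊1 / δ i x⌋₊ : ℝ) * δ i x - 1| ≤ 1 / 2 := by
      rw [abs_le]; constructor <;> linarith
    rw [min_eq_left (by linarith)]
    simp

/-! ### Maps of the Hilbert cube into convex sets -/

section Maps

variable {L : Type*} [AddCommGroup L] [Module ℝ L] [TopologicalSpace L] [IsTopologicalAddGroup L]
  [ContinuousSMul ℝ L] [LocallyConvexSpace ℝ L]

/-- Near each point of Q a constant from D approximates h. A partition of unity glues these
constants, and convexity of D and of the neighbourhood W preserves both membership in D and
closeness to h. -/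
theorem dense_setOf_forall_mem_of_convex {Q : Type*} [TopologicalSpace Q] [CompactSpace Q]
    [T2Space Q] {X : Set L} {D : Set X} (hD : Dense D)
    (hDc : Convex ℝ (Subtype.val '' D)) :
    Dense {h : C(Q, X) | ∀ q, h q ∈ D} := by
  let : UniformSpace L := IsTopologicalAddGroup.rightUniformSpace L
  have : IsUniformAddGroup L := isUniformAddGroup_of_addCommGroup
  intro h
  have hemb : Topology.IsInducing (fun g : C(Q, X) =>
      (⟨Subtype.val, continuous_subtype_val⟩ : C(X, L)).comp g) :=
    ContinuousMap.isInducing_postcomp _ Topology.IsInducing.subtypeVal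
  rw [mem_closure_iff_nhds]
  intro t ht
  rw [hemb.nhds_eq_comap] at ht
  obtain ⟨t', ht', htt'⟩ := ht
  rw [nhds_eq_comap_uniformity] at ht'
  obtain ⟨U, hU, hUt⟩ := ht'
  rw [(ContinuousMap.hasBasis_compactConvergenceUniformity_of_compact).mem_iff] at hU
  obtain ⟨T, hT, hTU⟩ := hU
  rw [uniformity_eq_comap_nhds_zero L] at hT
  obtain ⟨W₀, hW₀, hWT⟩ := hT
  obtain ⟨W, ⟨hW0, hWo, hWc⟩, hWW⟩ :=
    (LocallyConvexSpace.convex_open_basis_zero ℝ L).mem_iff.1 hW₀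
  obtain ⟨g, hg⟩ := exists_continuous_forall_mem_convex_of_local_const (X := Q) (E := L)
    (t := fun q => Subtype.val '' D ∩ {z | z - (h q : L) ∈ W})
    (fun q => hDc.inter (by
      have : {z | z - (h q : L) ∈ W} = (fun z => z + (-(h q : L))) ⁻¹' W := by
        ext; simp [sub_eq_add_neg]
      rw [this]
      exact hWc.translate_preimage_left _))
    (fun q => by
      have : {z : X | (z : L) - h q ∈ W} ∈ 𝓝 (h q) :=
        (hWo.preimage (by fun_prop)).mem_nhds (by simpa using hW0)
      obtain ⟨c, hcD, hc⟩ := hD.inter_nhds_nonempty this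
      refine ⟨c, ?_⟩
      have : {y : Q | (c : L) - h y ∈ W} ∈ 𝓝 q :=
        (hWo.preimage (by fun_prop)).mem_nhds hc
      filter_upwards [this] with y hy using ⟨⟨c, hcD, rfl⟩, hy⟩)
  have hgX (q : Q) : g q ∈ X := by
    obtain ⟨⟨c, -, hc⟩, -⟩ := hg q
    exact hc ▸ c.2
  refine ⟨⟨fun q => ⟨g q, hgX q⟩, by fun_prop⟩, htt' (hUt (hTU fun q => hWT (hWW ?_))), fun q => ?_⟩
  · exact (hg q).2
  · obtain ⟨⟨c, hcD, hc⟩, -⟩ := hg q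
    have : c = ⟨g q, hgX q⟩ := Subtype.ext hc
    rwa [this] at hcD

/-- Take h near g missing Z_0, …, Z_s. Missing a closed set is an open condition on maps of a
compact space, so h may also be moved into D. The interpolation g + b (h - g) does the rest. -/
theorem exists_continuousMap_avoiding {X : Set L} {D : Set X} (hD : Dense D)
    (hDc : Convex ℝ (Subtype.val '' D)) (Z : ℕ → Set X) (hZ : ∀ i, IsZSet (Z i)) (s : ℕ)
    (b : C(HilbertCube, ℝ)) (hb : ∀ x, b x ∈ Icc (0 : ℝ) 1) (g : C(HilbertCube, L))
    (hg : ∀ x, g x ∈ Subtype.val '' D) {G : Set C(HilbertCube, L)} (hG : G ∈ 𝓝 g) :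
    ∃ g' ∈ G, (∀ x, g' x ∈ Subtype.val '' D) ∧ (∀ x, b x = 0 → g' x = g x) ∧
      ∀ x, b x = 1 → ∀ j ≤ s, g' x ∉ Subtype.val '' Z j := by
  have hgX (q) : g q ∈ X := by
    obtain ⟨c, -, hc⟩ := hg q
    exact hc ▸ c.2
  let g₀ : C(HilbertCube, X) := ⟨fun q => ⟨g q, hgX q⟩, by fun_prop⟩
  let Φ : C(HilbertCube, X) → C(HilbertCube, L) := fun h =>
    ⟨fun q => g q + b q • ((h q : L) - g q), by fun_prop⟩
  have hΦ : Continuous Φ := by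
    refine ContinuousMap.continuous_of_continuous_uncurry _ ?_
    change Continuous fun p : C(HilbertCube, X) × HilbertCube =>
      g p.2 + b p.2 • ((p.1 p.2 : L) - g p.2)
    fun_prop
  have hΦg : Φ g₀ = g := by ext q; simp [Φ, g₀]
  have hop (i : ℕ) : IsOpen {h : C(HilbertCube, X) | ∀ q, h q ∉ Z i} := by
    have := ContinuousMap.isOpen_setOfPred_mapsTo (X := HilbertCube) (Y := X) isCompact_univ
      (hZ i).1.isOpen_compl
    convert this using 3
    simp [MapsTo]
  have hden : Dense (⋂ i ∈ Iic s, {h : C(HilbertCube, X) | ∀ q, h q ∉ Z i}) ∧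
      IsOpen (⋂ i ∈ Iic s, {h : C(HilbertCube, X) | ∀ q, h q ∉ Z i}) := by
    refine ⟨?_, (finite_Iic s).isOpen_biInter fun i _ => hop i⟩
    have key (t : Finset ℕ) : Dense (⋂ i ∈ t, {h : C(HilbertCube, X) | ∀ q, h q ∉ Z i}) := by
      induction t using Finset.induction_on with
      | empty => simp
      | insert a t _ ih =>
        rw [Finset.set_biInter_insert]
        exact (hZ a).2.inter_of_isOpen_left ih (hop a)
    simpa using key (Finset.Iic s)
  have hpre : Φ ⁻¹' (interior G) ∈ 𝓝 g₀ :=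
    (isOpen_interior.preimage hΦ).mem_nhds (by
      rw [mem_preimage, hΦg]
      exact mem_interior_iff_mem_nhds.2 hG)
  obtain ⟨h₁, hh₁, hh₁'⟩ := hden.1.inter_nhds_nonempty hpre
  obtain ⟨h₂, ⟨hh₂, hh₂'⟩, hh₂D⟩ :=
    (dense_setOf_forall_mem_of_convex (Q := HilbertCube) hD hDc).inter_open_nonempty _
    ((isOpen_interior.preimage hΦ).inter hden.2) ⟨h₁, hh₁', hh₁⟩
  refine ⟨Φ h₂, interior_subset hh₂, fun x => ?_, fun x hx => ?_, fun x hx j hj => ?_⟩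
  · have := hDc (hg x) ⟨h₂ x, hh₂D x, rfl⟩ (sub_nonneg.2 (hb x).2) (hb x).1 (by ring)
    convert this using 1
    simp only [Φ, ContinuousMap.coe_mk]
    module
  · simp [Φ, hx]
  · have h3 : Φ h₂ x = h₂ x := by simp [Φ, hx]
    rw [h3]
    rintro ⟨z, hz, hz'⟩
    have := mem_iInter₂.1 hh₂' j hj x
    exact this (Subtype.ext hz' ▸ hz)

theorem exists_continuousMap_of_isZSet [IsCompletelyMetrizableSpace L] {X : Set L} (hX : IsGδ X)
    {D : Set X} (hne : D.Nonempty) (hD : Dense D)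
    (hDc : Convex ℝ (Subtype.val '' D)) (Z : ℕ → Set X) (hZ : ∀ i, IsZSet (Z i))
    (F : ℕ → Set HilbertCube) (hF : ∀ i, IsClosed (F i)) :
    ∃ f : C(HilbertCube, X), (∀ x ∈ ⋃ i, F i, f x ∈ D) ∧
      ∀ x ∉ ⋃ i, F i, ∀ i, f x ∉ Z i := by
  let := upgradeIsCompletelyMetrizable L
  obtain ⟨b, hb, hb0, hb1⟩ := exists_bump_sequence F hF
  obtain ⟨O, hO, hXO⟩ := isGδ_iff_eq_iInter_nat.1 hX
  choose C hC hZC using fun i => isClosed_induced_iff.1 (hZ i).1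
  -- The conditions are stated in L, with open O_s ⊇ X and closed C_j tracing Z_j on X, so that they
  -- are open in the complete space C(HilbertCube, L) and survive in closed balls.
  let good : ℕ → Set C(HilbertCube, L) := fun s =>
    {g | MapsTo g univ (O s)} ∩ {g | MapsTo g (b s ⁻¹' {1}) (⋃ j ∈ Iic s, C j)ᶜ}
  have hgood (s : ℕ) : IsOpen (good s) := by
    refine (ContinuousMap.isOpen_setOfPred_mapsTo isCompact_univ (hO s)).inter
      (ContinuousMap.isOpen_setOfPred_mapsTo ?_ ?_)
    · exact (isClosed_singleton.preimage (b s).continuous).isCompact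
    · exact ((finite_Iic s).isClosed_biUnion fun j _ => hC j).isOpen_compl
  let P := {p : C(HilbertCube, L) × ℝ // (∀ x, p.1 x ∈ Subtype.val '' D) ∧ 0 < p.2}
  have step (s : ℕ) (p : P) : ∃ p' : P,
      Metric.closedBall p'.1.1 p'.1.2 ⊆ Metric.closedBall p.1.1 p.1.2 ∩ good s ∧
      p'.1.2 ≤ (1 / 2) ^ s ∧ ∀ x, b s x = 0 → p'.1.1 x = p.1.1 x := by
    obtain ⟨⟨g, r⟩, hg, hr⟩ := p
    obtain ⟨g', hg'1, hg'2, hg'3, hg'4⟩ := exists_continuousMap_avoiding hD hDc Z hZ s (b s) (hb s)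
      g hg (Metric.ball_mem_nhds g hr)
    have hg'X (x) : g' x ∈ X := by
      obtain ⟨c, -, hc⟩ := hg'2 x
      exact hc ▸ c.2
    have hg'good : g' ∈ good s := by
      refine ⟨fun x _ => ?_, fun x hx => ?_⟩
      · have := hg'X x
        rw [hXO] at this
        exact mem_iInter.1 this s
      · simp only [mem_compl_iff, mem_iUnion, not_exists]
        intro j hj hxC
        refine hg'4 x hx j hj ⟨⟨g' x, hg'X x⟩, ?_, rfl⟩
        rw [← hZC j]
        exact hxC
    have hmem : Metric.ball g r ∩ good s ∈ 𝓝 g' :=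
      (Metric.isOpen_ball.inter (hgood s)).mem_nhds ⟨hg'1, hg'good⟩
    obtain ⟨r', hr', hr's⟩ := Metric.nhds_basis_closedBall.mem_iff.1 hmem
    refine ⟨⟨⟨g', min r' ((1 / 2) ^ s)⟩, hg'2, by positivity⟩, ?_, min_le_right _ _, hg'3⟩
    exact (Metric.closedBall_subset_closedBall (min_le_left _ _)).trans
      (hr's.trans (inter_subset_inter_left _ Metric.ball_subset_closedBall))
  choose! nxt hnxt1 hnxt2 hnxt3 using step
  obtain ⟨d, hd⟩ := hne
  let p₀ : P := ⟨⟨ContinuousMap.const _ (d : L), 1⟩, fun x => ⟨d, hd, rfl⟩, one_pos⟩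
  let p : ℕ → P := fun s => Nat.rec p₀ nxt s
  have hp (s : ℕ) : p (s + 1) = nxt s (p s) := rfl
  have hanti : Antitone fun s => Metric.closedBall (p s).1.1 (p s).1.2 :=
    antitone_nat_of_succ_le fun s => by
      rw [hp]
      exact (hnxt1 s (p s)).trans inter_subset_left
  have hmem {s t : ℕ} (hst : s ≤ t) : (p t).1.1 ∈ Metric.closedBall (p s).1.1 (p s).1.2 :=
    hanti hst (Metric.mem_closedBall_self (p t).2.2.le)
  have hcauchy : CauchySeq fun s => (p (s + 1)).1.1 := by
    refine cauchySeq_of_le_tendsto_0' (fun s => (1 / 2 : ℝ) ^ s) (fun s t hst => ?_)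
      (tendsto_pow_atTop_nhds_zero_of_lt_one (by norm_num) (by norm_num))
    rw [dist_comm]
    exact (hmem (Nat.succ_le_succ hst)).trans (hnxt2 s (p s))
  obtain ⟨f, hf⟩ := cauchySeq_tendsto_of_complete hcauchy
  have hf' : Tendsto (fun s => (p s).1.1) atTop (𝓝 f) := (tendsto_add_atTop_iff_nat 1).1 hf
  have hball (s : ℕ) : f ∈ Metric.closedBall (p s).1.1 (p s).1.2 :=
    Metric.isClosed_closedBall.mem_of_tendsto hf'
      (eventually_atTop.2 ⟨s, fun t ht => hmem ht⟩)
  have hfgood (s : ℕ) : f ∈ good s := (hnxt1 s (p s) (hball (s + 1))).2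
  have hfX (x) : f x ∈ X := by
    rw [hXO]
    exact mem_iInter.2 fun s => (hfgood s).1 (mem_univ x)
  refine ⟨⟨fun x => ⟨f x, hfX x⟩, by fun_prop⟩, fun x hx => ?_, fun x hx i hi => ?_⟩
  -- Past N all bumps vanish at x, so the sequence is constant there and its limit is a value in D.
  · obtain ⟨N, hN⟩ := eventually_atTop.1 (hb0 x hx)
    have hconst (s : ℕ) (hs : N ≤ s) : (p s).1.1 x = (p N).1.1 x := by
      induction s, hs using Nat.le_induction with
      | base => rfl
      | succ s hs ih => rw [hp, hnxt3 s (p s) x (hN s hs), ih]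
    have hlim : Tendsto (fun s => (p s).1.1 x) atTop (𝓝 (f x)) :=
      ((continuous_eval_const x).tendsto f).comp hf'
    have heq : f x = (p N).1.1 x :=
      tendsto_nhds_unique hlim (tendsto_const_nhds.congr' (eventually_atTop.2
        ⟨N, fun s hs => (hconst s hs).symm⟩))
    obtain ⟨c, hcD, hc⟩ := (p N).2.1 x
    have : c = ⟨f x, hfX x⟩ := Subtype.ext (hc.trans heq.symm)
    rwa [this] at hcD
  · obtain ⟨s, hs, hs1⟩ := frequently_atTop.1 (hb1 x hx) i
    refine (hfgood s).2 hs1 (mem_biUnion (show i ∈ Iic s from hs) ?_)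
    rw [← hZC i] at hi
    exact hi

end Maps

/-! ### Derivatives of locally uniform limits within locally convex sets -/

/-- The mean value inequality on a small convex piece of s bounds the increments of f_m - f_n
uniformly in m. Local convexity replaces openness of s, as chart images may have boundary or
corners. -/
theorem hasFDerivWithinAt_of_tendstoLocallyUniformlyOn {E F ι : Type*} [NormedAddCommGroup E]
    [NormedSpace ℝ E] [NormedAddCommGroup F] [NormedSpace ℝ F] {s : Set E} {x : E} (hx : x ∈ s)
    (hs : ∀ t ∈ 𝓝[s] x, ∃ t' ⊆ t, t' ⊆ s ∧ Convex ℝ t' ∧ t' ∈ 𝓝[s] x) {l : Filter ι} [l.NeBot]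
    {f : ι → E → F} {f' : ι → E → E →L[ℝ] F} {g : E → F} {g' : E → E →L[ℝ] F}
    (hf : ∀ i, ∀ y ∈ s, HasFDerivWithinAt (f i) (f' i y) s y)
    (hfg : ∀ y ∈ s, Tendsto (fun i => f i y) l (𝓝 (g y)))
    (hf' : TendstoLocallyUniformlyOn f' g' l s) : HasFDerivWithinAt g (g' x) s x := by
  rw [hasFDerivWithinAt_iff_isLittleO, Asymptotics.isLittleO_iff]
  intro c hc
  -- The error splits into three terms with coefficients 2ε, ε and ε.
  set ε := c / 4 with hε
  have hε0 : 0 < ε := by positivity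
  obtain ⟨t, ht, hft⟩ := Metric.tendstoLocallyUniformlyOn_iff.1 hf' ε hε0 x hx
  obtain ⟨t', htt', hts', hconv, ht'⟩ := hs t ht
  have hxt' : x ∈ t' := mem_of_mem_nhdsWithin hx ht'
  obtain ⟨n, hn⟩ := hft.exists
  have hmn : ∀ᶠ m in l, ∀ y ∈ t', ‖(f m y - f n y) - (f m x - f n x)‖ ≤ 2 * ε * ‖y - x‖ := by
    filter_upwards [hft] with m hm y hy
    refine hconv.norm_image_sub_le_of_norm_hasFDerivWithin_le (f := fun y => f m y - f n y)
      (f' := fun y => f' m y - f' n y)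
      (fun z hz => ((hf m z (hts' hz)).sub (hf n z (hts' hz))).mono hts') (fun z hz => ?_) hxt' hy
    have h1 := hm z (htt' hz)
    have h2 := hn z (htt' hz)
    rw [dist_comm] at h1
    rw [← dist_eq_norm]
    linarith [dist_triangle (f' m z) (g' z) (f' n z)]
  have hgn (y) (hy : y ∈ t') : ‖(g y - f n y) - (g x - f n x)‖ ≤ 2 * ε * ‖y - x‖ := by
    have h1 := ((hfg y (hts' hy)).sub_const (f n y)).sub ((hfg x hx).sub_const (f n x))
    exact le_of_tendsto h1.norm (hmn.mono fun m hm => hm y hy)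
  have hfn := Asymptotics.isLittleO_iff.1 (hasFDerivWithinAt_iff_isLittleO.1 (hf n x hx)) hε0
  filter_upwards [hfn, ht'] with y hy hyt'
  have h1 := hgn y hyt'
  have h2 : ‖(f' n x - g' x) (y - x)‖ ≤ ε * ‖y - x‖ := by
    refine (f' n x - g' x).le_of_opNorm_le ?_ _
    rw [← dist_eq_norm, dist_comm]
    exact (hn x (htt' hxt')).le
  have h3 : g y - g x - g' x (y - x) = ((g y - f n y) - (g x - f n x)) +
      (f n y - f n x - f' n x (y - x)) + (f' n x - g' x) (y - x) := by
    rw [sub_apply]; abel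
  rw [h3]
  refine (norm_add₃_le).trans ?_
  have : c * ‖y - x‖ = 2 * ε * ‖y - x‖ + ε * ‖y - x‖ + ε * ‖y - x‖ := by rw [hε]; ring
  linarith

instance ContinuousMap.instIsUniformAddGroup {X G : Type*} [TopologicalSpace X]
    [AddGroup G] [UniformSpace G] [IsUniformAddGroup G] : IsUniformAddGroup C(X, G) :=
  IsUniformInducing.isUniformAddGroup
    (⟨⟨toUniformOnFunIsCompact, rfl⟩, fun _ _ => rfl⟩ :
      C(X, G) →+ UniformOnFun X G {K | IsCompact K})
    isUniformEmbedding_toUniformOnFunIsCompact.isUniformInducing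

/-! ### Local geometry of chart images and derivatives in charts -/

section ExtChart

variable {E : Type u} [NormedAddCommGroup E] [NormedSpace ℝ E]
  {H : Type v} [TopologicalSpace H] {I : ModelWithCorners ℝ E H}
  {V : Type w} [TopologicalSpace V] [ChartedSpace H V]

theorem exists_isOpen_extChartAt_target_eq (x : V) :
    ∃ O : Set E, IsOpen O ∧ (extChartAt I x).target = O ∩ range I :=
  ⟨_, (chartAt H x).open_target.preimage I.continuous_symm, extChartAt_target I x⟩

instance locallyCompactSpace_extChartAt_target [FiniteDimensional ℝ E] (x : V) :
    LocallyCompactSpace (extChartAt I x).target := by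
  obtain ⟨O, hO, h⟩ := exists_isOpen_extChartAt_target_eq (I := I) x
  rw [h]
  exact (hO.isLocallyClosed.inter I.isClosed_range.isLocallyClosed).locallyCompactSpace

theorem exists_convex_nhdsWithin_extChartAt_target (x : V) {z : E}
    (hz : z ∈ (extChartAt I x).target) {t : Set E} (ht : t ∈ 𝓝[(extChartAt I x).target] z) :
    ∃ t' ⊆ t, t' ⊆ (extChartAt I x).target ∧ Convex ℝ t' ∧
      t' ∈ 𝓝[(extChartAt I x).target] z := by
  obtain ⟨O, hO, h⟩ := exists_isOpen_extChartAt_target_eq (I := I) x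
  rw [h] at hz ht ⊢
  obtain ⟨r, hr, hrt⟩ := Metric.mem_nhdsWithin_iff.1 ht
  obtain ⟨r', hr', hrO⟩ := Metric.isOpen_iff.1 hO z hz.1
  refine ⟨Metric.ball z (min r r') ∩ range I, ?_, ?_, (convex_ball _ _).inter I.convex_range, ?_⟩
  · exact fun y hy => hrt ⟨Metric.ball_subset_ball (min_le_left _ _) hy.1,
      hrO (Metric.ball_subset_ball (min_le_right _ _) hy.1), hy.2⟩
  · exact fun y hy => ⟨hrO (Metric.ball_subset_ball (min_le_right _ _) hy.1), hy.2⟩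
  · exact mem_nhdsWithin.2 ⟨_, Metric.isOpen_ball, Metric.mem_ball_self (by positivity),
      fun y hy => ⟨hy.1, hy.2.2⟩⟩

variable [IsManifold I ∞ V]

theorem CkFun.contDiffOn_comp_symm {k : ℕ} (f : CkFun I V k) (x : V) :
    ContDiffOn ℝ k (f ∘ (extChartAt I x).symm) (extChartAt I x).target :=
  contMDiffOn_iff_contDiffOn.1
    (f.contMDiff.comp_contMDiffOn (contMDiffOn_extChartAt_symm (n := (k : ℕ)) x))

theorem contMDiff_of_contDiffOn_comp_symm {k : ℕ} {f : V → ℝ}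
    (h : ∀ x : V, ContDiffOn ℝ k (f ∘ (extChartAt I x).symm) (extChartAt I x).target) :
    ContMDiff I 𝓘(ℝ, ℝ) k f := by
  intro x
  have h1 : ContMDiffOn I 𝓘(ℝ, ℝ) k ((f ∘ (extChartAt I x).symm) ∘ extChartAt I x)
      (chartAt H x).source :=
    (contMDiffOn_iff_contDiffOn.2 (h x)).comp (contMDiffOn_extChartAt (n := (k : ℕ)))
      (fun y hy => (extChartAt I x).map_source (by rwa [extChartAt_source]))
  have h2 : ContMDiffOn I 𝓘(ℝ, ℝ) k f (chartAt H x).source :=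
    h1.congr fun y hy => by
      have hy' : y ∈ (extChartAt I x).source := by rwa [extChartAt_source]
      simp only [Function.comp_apply, (extChartAt I x).left_inv hy']
  exact h2.contMDiffAt ((chartAt H x).open_source.mem_nhds (mem_chart_source H x))

theorem iteratedFDerivWithin_sub_comp_symm {k : ℕ} (f g : CkFun I V k) (x : V) {j : ℕ}
    (hj : j ≤ k) {z : E} (hz : z ∈ (extChartAt I x).target) :
    iteratedFDerivWithin ℝ j ((f - g : CkFun I V k) ∘ (extChartAt I x).symm)
        (extChartAt I x).target z =
      iteratedFDerivWithin ℝ j (f ∘ (extChartAt I x).symm) (extChartAt I x).target z -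
      iteratedFDerivWithin ℝ j (g ∘ (extChartAt I x).symm) (extChartAt I x).target z :=
  iteratedFDerivWithin_sub_apply
    (((f.contDiffOn_comp_symm x).of_le (by exact_mod_cast hj)) z hz)
    (((g.contDiffOn_comp_symm x).of_le (by exact_mod_cast hj)) z hz)
    (uniqueDiffOn_extChartAt_target x) hz

/-- The map `f ↦ chartDeriv f x j` as a linear map. -/
noncomputable def chartDerivLinear (k : ℕ) (x : V) (j : Fin (k + 1)) :
    CkFun I V k →ₗ[ℝ] C((extChartAt I x).target, E [×(j : ℕ)]→L[ℝ] ℝ) where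
  toFun f := chartDeriv f x j
  map_add' f g := by
    ext1 z
    exact iteratedFDerivWithin_add_apply
      (((f.contDiffOn_comp_symm x).of_le (by exact_mod_cast Nat.lt_succ_iff.1 j.2)) z z.2)
      (((g.contDiffOn_comp_symm x).of_le (by exact_mod_cast Nat.lt_succ_iff.1 j.2)) z z.2)
      (uniqueDiffOn_extChartAt_target x) z.2
  map_smul' c f := by
    ext1 z
    exact iteratedFDerivWithin_const_smul_apply (a := c)
      (((f.contDiffOn_comp_symm x).of_le (by exact_mod_cast Nat.lt_succ_iff.1 j.2)) z z.2)
      (uniqueDiffOn_extChartAt_target x) z.2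

/-- The family of all derivatives in all charts, as a linear map. -/
noncomputable def CkFun.jet (I : ModelWithCorners ℝ E H) (V : Type w) [TopologicalSpace V]
    [ChartedSpace H V] [IsManifold I ∞ V] (k : ℕ) : CkFun I V k →ₗ[ℝ]
    ((x : V) → (j : Fin (k + 1)) → C((extChartAt I x).target, E [×(j : ℕ)]→L[ℝ] ℝ)) :=
  LinearMap.pi fun x => LinearMap.pi fun j => chartDerivLinear k x j

theorem CkFun.isInducing_jet (k : ℕ) : Topology.IsInducing (CkFun.jet I V k) := ⟨rfl⟩

theorem chartDeriv_zero_apply {k : ℕ} (f : CkFun I V k) (x : V) (z : (extChartAt I x).target)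
    (m : Fin 0 → E) : chartDeriv f x 0 z m = f ((extChartAt I x).symm z) :=
  iteratedFDerivWithin_zero_apply (𝕜 := ℝ) (s := (extChartAt I x).target) m

theorem tendsto_chartDeriv_iff [FiniteDimensional ℝ E] {ι : Type*} {l : Filter ι} {k : ℕ}
    {f : ι → CkFun I V k} {g : CkFun I V k} {x : V} {j : Fin (k + 1)} :
    Tendsto (fun i => chartDeriv (f i) x j) l (𝓝 (chartDeriv g x j)) ↔
      TendstoLocallyUniformlyOn
        (fun i => iteratedFDerivWithin ℝ j (f i ∘ (extChartAt I x).symm) (extChartAt I x).target)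
        (iteratedFDerivWithin ℝ j (g ∘ (extChartAt I x).symm) (extChartAt I x).target) l
        (extChartAt I x).target := by
  rw [ContinuousMap.tendsto_iff_tendstoLocallyUniformly,
    tendstoLocallyUniformlyOn_iff_tendstoLocallyUniformly_comp_coe]
  rfl

/-- Derivatives in one chart are bounded by those in another through the chain rule for the smooth
transition map ψ. Thus a countable family of charts suffices to test convergence, which gives first
countability. -/
theorem tendsto_chartDeriv_of_cover [FiniteDimensional ℝ E] {ι : Type*} {l : Filter ι} {k : ℕ}
    {f : ι → CkFun I V k} {g : CkFun I V k} {C : Set V}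
    (hC : ∀ p : V, ∃ c ∈ C, p ∈ (extChartAt I c).source)
    (h : ∀ c ∈ C, ∀ j, Tendsto (fun i => chartDeriv (f i) c j) l (𝓝 (chartDeriv g c j)))
    (x : V) (j : Fin (k + 1)) :
    Tendsto (fun i => chartDeriv (f i) x j) l (𝓝 (chartDeriv g x j)) := by
  rw [tendsto_chartDeriv_iff, Metric.tendstoLocallyUniformlyOn_iff]
  intro ε hε z hz
  obtain ⟨c, hcC, hc⟩ := hC ((extChartAt I x).symm z)
  set ψ := extChartAt I c ∘ (extChartAt I x).symm with hψ
  set U := ((extChartAt I x).symm.trans (extChartAt I c)).source with hU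
  have hUdef : U = (extChartAt I x).target ∩
      (extChartAt I x).symm ⁻¹' (extChartAt I c).source := by
    rw [hU, PartialEquiv.trans_source, PartialEquiv.symm_source]
  have hUT : U ⊆ (extChartAt I x).target := hUdef ▸ inter_subset_left
  have hzU : z ∈ U := by rw [hUdef]; exact ⟨hz, hc⟩
  have hUn (y) (hy : y ∈ U) : 𝓝[(extChartAt I x).target] y = 𝓝[U] y := by
    rw [hUdef] at hy ⊢
    refine (nhdsWithin_inter_of_mem' ?_).symm
    exact (continuousOn_extChartAt_symm x y hy.1).preimage_mem_nhdsWithin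
      ((isOpen_extChartAt_source c).mem_nhds hy.2)
  have hUu : UniqueDiffOn ℝ U := fun y hy =>
    (uniqueDiffOn_extChartAt_target x y (hUT hy)).mono_nhds (hUn y hy).le
  have hψd : ContDiffOn ℝ ∞ ψ U := contDiffOn_ext_coord_change c x
  have hψm : MapsTo ψ U (extChartAt I c).target := fun y hy => by
    rw [hUdef] at hy
    exact (extChartAt I c).map_source hy.2
  -- The bound on derivatives of a composition asks for ‖D^i ψ‖ ≤ B^i, which follows from ‖D^i ψ‖ ≤
  -- B since B ≥ 1 and i ≥ 1. It gives j! δ B^j, whence the choice of δ.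
  obtain ⟨B, hB1, hB⟩ : ∃ B : ℝ, 1 ≤ B ∧ ∀ i ≤ (j : ℕ), ‖iteratedFDerivWithin ℝ i ψ U z‖ < B := by
    refine ⟨1 + ∑ i ∈ Finset.range (j + 1), ‖iteratedFDerivWithin ℝ i ψ U z‖, ?_, fun i hi => ?_⟩
    · have : 0 ≤ ∑ i ∈ Finset.range (j + 1), ‖iteratedFDerivWithin ℝ i ψ U z‖ :=
        Finset.sum_nonneg fun _ _ => norm_nonneg _
      linarith
    · have := Finset.single_le_sum (f := fun i => ‖iteratedFDerivWithin ℝ i ψ U z‖)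
        (fun _ _ => norm_nonneg _) (Finset.mem_range.2 (Nat.lt_succ_iff.2 hi))
      linarith
  have hBev : ∀ᶠ y in 𝓝[U] z, ∀ i ≤ (j : ℕ), ‖iteratedFDerivWithin ℝ i ψ U y‖ < B := by
    refine (finite_Iic (j : ℕ)).eventually_all.2 fun i hi => ?_
    have hcont := hψd.continuousOn_iteratedFDerivWithin (m := i) (by exact_mod_cast le_top) hUu
    exact (hcont z hzU).norm.eventually_lt_const (hB i hi)
  obtain ⟨δ, hδ, hδε⟩ : ∃ δ : ℝ, 0 < δ ∧ (j : ℕ).factorial * δ * B ^ (j : ℕ) < ε := by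
    have hpos : 0 < ((j : ℕ).factorial : ℝ) * B ^ (j : ℕ) := by positivity
    refine ⟨ε / 2 / ((j : ℕ).factorial * B ^ (j : ℕ)), by positivity, ?_⟩
    have : ((j : ℕ).factorial : ℝ) * (ε / 2 / ((j : ℕ).factorial * B ^ (j : ℕ))) * B ^ (j : ℕ)
        = ε / 2 := by field_simp
    linarith
  have hloc (i : Fin (k + 1)) := Metric.tendstoLocallyUniformlyOn_iff.1
    (tendsto_chartDeriv_iff.1 (h c hcC i)) δ hδ (ψ z) (hψm hzU)
  choose t ht htl using hloc
  have htψ : ∀ᶠ y in 𝓝[U] z, ∀ i, ψ y ∈ t i := by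
    rw [eventually_all]
    intro i
    exact (tendsto_nhdsWithin_iff.2 ⟨hψd.continuousOn z hzU,
      eventually_mem_nhdsWithin.mono fun y hy => hψm hy⟩) (ht i)
  refine ⟨{y | y ∈ U ∧ (∀ i ≤ (j : ℕ), ‖iteratedFDerivWithin ℝ i ψ U y‖ < B) ∧ ∀ i, ψ y ∈ t i},
    ?_, ?_⟩
  · rw [hUn z hzU]
    filter_upwards [self_mem_nhdsWithin, hBev, htψ] with y h1 h2 h3 using ⟨h1, h2, h3⟩
  · filter_upwards [eventually_all.2 htl] with m hm y hy
    obtain ⟨hyU, hyB, hyt⟩ := hy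
    have hjk : (j : ℕ) ≤ k := Nat.lt_succ_iff.1 j.2
    rw [dist_eq_norm, ← iteratedFDerivWithin_sub_comp_symm _ _ _ hjk (hUT hyU),
      ← iteratedFDerivWithin_congr_set (nhdsWithin_eq_iff_eventuallyEq.1 (hUn y hyU).symm)]
    have hcongr : EqOn (((g - f m : CkFun I V k) : V → ℝ) ∘ (extChartAt I x).symm)
        ((((g - f m : CkFun I V k) : V → ℝ) ∘ (extChartAt I c).symm) ∘ ψ) U := fun y' hy' => by
      rw [hUdef] at hy'
      simp only [hψ, Function.comp_apply, (extChartAt I c).left_inv hy'.2]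
    rw [iteratedFDerivWithin_congr hcongr hyU]
    refine lt_of_le_of_lt (norm_iteratedFDerivWithin_comp_le (N := ((j : ℕ) : ℕ∞)) (C := δ) (D := B)
      (((g - f m).contDiffOn_comp_symm c).of_le (by exact_mod_cast hjk))
      (hψd.of_le (by exact_mod_cast le_top)) le_rfl (uniqueDiffOn_extChartAt_target c) hUu hψm hyU
      (fun i hi => ?_) (fun i hi1 hi => ?_)) hδε
    · rw [iteratedFDerivWithin_sub_comp_symm _ _ _ (hi.trans hjk) (hψm hyU), ← dist_eq_norm]
      exact (hm ⟨i, Nat.lt_succ_iff.2 (hi.trans hjk)⟩ (ψ y) (hyt _)).le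
    · exact (hyB i hi).le.trans (le_self_pow₀ hB1 (by omega))

end ExtChart

/-! ### The spaces `C^k(V)` as Fréchet spaces -/

section Frechet

variable {E : Type u} [NormedAddCommGroup E] [NormedSpace ℝ E]
  {H : Type v} [TopologicalSpace H] {I : ModelWithCorners ℝ E H}
  {V : Type w} [TopologicalSpace V] [ChartedSpace H V] [IsManifold I ∞ V]

noncomputable instance CkFun.instUniformSpace (k : ℕ) : UniformSpace (CkFun I V k) :=
  (UniformSpace.comap (CkFun.jet I V k) inferInstance).replaceTopology rfl

theorem CkFun.isUniformInducing_jet (k : ℕ) : IsUniformInducing (CkFun.jet I V k) := ⟨rfl⟩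

instance CkFun.instIsUniformAddGroup (k : ℕ) : IsUniformAddGroup (CkFun I V k) :=
  (CkFun.isUniformInducing_jet k).isUniformAddGroup

instance CkFun.instContinuousSMul (k : ℕ) : ContinuousSMul ℝ (CkFun I V k) :=
  continuousSMul_induced (CkFun.jet I V k)

instance CkFun.instLocallyConvexSpace (k : ℕ) : LocallyConvexSpace ℝ (CkFun I V k) :=
  LocallyConvexSpace.induced (CkFun.jet I V k)

theorem CkFun.continuous_chartDeriv (k : ℕ) (x : V) (j : Fin (k + 1)) :
    Continuous fun f : CkFun I V k => chartDeriv f x j :=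
  ((continuous_apply j).comp (continuous_apply x)).comp (CkFun.isInducing_jet k).continuous

theorem CkFun.continuous_eval (k : ℕ) (p : V) : Continuous fun f : CkFun I V k => f p := by
  have h : Continuous fun f : CkFun I V k =>
      chartDeriv f p 0 ⟨extChartAt I p p, mem_extChartAt_target p⟩ 0 :=
    (ContinuousEvalConst.continuous_eval_const (F := E [×((0 : Fin (k + 1)) : ℕ)]→L[ℝ] ℝ) 0).comp
      ((continuous_eval_const _).comp (CkFun.continuous_chartDeriv k p 0))
  refine h.congr fun f => ?_
  exact (chartDeriv_zero_apply f p _ 0).trans (congrArg f (extChartAt_to_inv p))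

instance CkFun.instT2Space (k : ℕ) : T2Space (CkFun I V k) := by
  refine T2Space.of_injective_continuous (f := fun (f : CkFun I V k) (p : V) => f p)
    (fun f g h => ContMDiffMap.ext fun p => congrFun h p)
    (continuous_pi fun p => CkFun.continuous_eval k p)

/-- The inclusion `C^k(V) ⊆ C^j(V)` for `j ≤ k`. -/
noncomputable def CkFun.incl {j k : ℕ} (h : j ≤ k) : CkFun I V k →L[ℝ] CkFun I V j where
  toFun f := ⟨f, f.contMDiff.of_le (by exact_mod_cast h)⟩
  map_add' _ _ := rfl
  map_smul' _ _ := rfl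
  cont := (CkFun.isInducing_jet j).continuous_iff.2 <| continuous_pi fun x => continuous_pi fun i =>
    CkFun.continuous_chartDeriv k x ⟨i, by omega⟩

@[simp]
theorem CkFun.coe_incl {j k : ℕ} (h : j ≤ k) (f : CkFun I V k) :
    (CkFun.incl h f : V → ℝ) = f := rfl

variable [FiniteDimensional ℝ E]

instance CkFun.instFirstCountableTopology [SigmaCompactSpace V] (k : ℕ) :
    FirstCountableTopology (CkFun I V k) := by
  obtain ⟨C, hCc, hC⟩ := countable_cover_nhds_of_sigmaCompact
    (f := fun x : V => (extChartAt I x).source) (fun x => extChartAt_source_mem_nhds x)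
  have hC' (p : V) : ∃ c ∈ C, p ∈ (extChartAt I c).source := by
    have : p ∈ ⋃ x ∈ C, (extChartAt I x).source := hC ▸ mem_univ p
    simpa using this
  have := hCc.to_subtype
  let r : CkFun I V k →
      ((c : C) → (j : Fin (k + 1)) → C((extChartAt I (c : V)).target, E [×(j : ℕ)]→L[ℝ] ℝ)) :=
    fun f c j => chartDeriv f c j
  refine ⟨fun f => ?_⟩
  have hnhds : 𝓝 f = comap r (𝓝 (r f)) := by
    refine le_antisymm (Tendsto.le_comap ?_) ?_
    · exact (continuous_pi fun c : C => continuous_pi fun j =>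
        CkFun.continuous_chartDeriv k (c : V) j).tendsto f
    · rw [(CkFun.isInducing_jet k).nhds_eq_comap, ← tendsto_iff_comap, tendsto_pi_nhds]
      intro x
      rw [tendsto_pi_nhds]
      refine fun j => tendsto_chartDeriv_of_cover hC' (fun c hc i => ?_) x j
      exact (((continuous_apply i).comp (continuous_apply (⟨c, hc⟩ : C))).tendsto (r f)).comp
        tendsto_comap
  rw [hnhds]
  infer_instance

open scoped Classical in
-- A limit P of jets is the jet of its own zeroth component: derivatives pass to locally uniform
-- limits, so P is a Taylor series in every chart. Completeness of C^k(V) follows from that of the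
-- jet space.
theorem CkFun.isClosed_range_jet (k : ℕ) : IsClosed (range (CkFun.jet I V k)) := by
  refine isClosed_of_closure_subset fun P hP => ?_
  set l := comap (CkFun.jet I V k) (𝓝 P) with hl
  have : l.NeBot := comap_neBot fun t ht => by
    obtain ⟨-, h, f, rfl⟩ := mem_closure_iff_nhds.1 hP t ht
    exact ⟨f, h⟩
  have hlim (x : V) (j : Fin (k + 1)) :
      Tendsto (fun f : CkFun I V k => chartDeriv f x j) l (𝓝 (P x j)) :=
    (((continuous_apply j).comp (continuous_apply x)).tendsto P).comp tendsto_comap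
  have hpt (x : V) (j : Fin (k + 1)) (z : (extChartAt I x).target) :
      Tendsto (fun f : CkFun I V k => chartDeriv f x j z) l (𝓝 (P x j z)) :=
    ((continuous_eval_const z).tendsto _).comp (hlim x j)
  let z₀ (x : V) : (extChartAt I x).target := ⟨extChartAt I x x, mem_extChartAt_target x⟩
  let g : V → ℝ := fun x => P x 0 (z₀ x) 0
  have hev (x : V) (z : (extChartAt I x).target) : Tendsto
      (fun f : CkFun I V k => f ((extChartAt I x).symm z)) l (𝓝 (P x 0 z 0)) := by
    have h := ((ContinuousEvalConst.continuous_eval_const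
      (F := E [×((0 : Fin (k + 1)) : ℕ)]→L[ℝ] ℝ) 0).tendsto _).comp (hpt x 0 z)
    exact h.congr fun f => chartDeriv_zero_apply f x z 0
  have hg (p : V) : Tendsto (fun f : CkFun I V k => f p) l (𝓝 (g p)) := by
    have := hev p (z₀ p)
    simpa only [z₀, extChartAt_to_inv] using this
  -- A formal series needs terms at all points and orders; the value 0 off the chart image or above
  -- order k is never used.
  let p : (x : V) → E → FormalMultilinearSeries ℝ E ℝ := fun x z m =>
    if h : z ∈ (extChartAt I x).target ∧ m < k + 1 then P x ⟨m, h.2⟩ ⟨z, h.1⟩ else 0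
  have hp (x : V) (m : ℕ) (hm : m < k + 1) (z : E) (hz : z ∈ (extChartAt I x).target) :
      p x z m = P x ⟨m, hm⟩ ⟨z, hz⟩ := dif_pos ⟨hz, hm⟩
  have hunif (x : V) (m : ℕ) (hm : m < k + 1) : TendstoLocallyUniformlyOn
      (fun (f : CkFun I V k) => iteratedFDerivWithin ℝ m (f ∘ (extChartAt I x).symm)
        (extChartAt I x).target) (fun z => p x z m) l (extChartAt I x).target := by
    rw [tendstoLocallyUniformlyOn_iff_tendstoLocallyUniformly_comp_coe]
    have h := ContinuousMap.tendsto_iff_tendstoLocallyUniformly.1 (hlim x ⟨m, hm⟩)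
    have heq : (fun z => p x z m) ∘ Subtype.val = P x ⟨m, hm⟩ := by
      ext1 z
      exact hp x m hm z z.2
    rw [heq]
    exact h
  have hT (x : V) : HasFTaylorSeriesUpToOn k (g ∘ (extChartAt I x).symm) (p x)
      (extChartAt I x).target := by
    refine ⟨fun z hz => ?_, fun m hm z hz => ?_, fun m hm => ?_⟩
    · rw [hp x 0 (Nat.succ_pos k) z hz]
      exact tendsto_nhds_unique (hev x ⟨z, hz⟩) (hg _)
    · have hm' : m < k := by exact_mod_cast hm
      have hu := hunif x (m + 1) (by omega)
      refine hasFDerivWithinAt_of_tendstoLocallyUniformlyOn (l := l) hz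
        (fun t ht => exists_convex_nhdsWithin_extChartAt_target x hz ht)
        (f := fun (f : CkFun I V k) => iteratedFDerivWithin ℝ m (f ∘ (extChartAt I x).symm)
          (extChartAt I x).target)
        (f' := fun (f : CkFun I V k) y => (iteratedFDerivWithin ℝ (m + 1)
          (f ∘ (extChartAt I x).symm) (extChartAt I x).target y).curryLeft)
        (g' := fun y => (p x y (m + 1)).curryLeft) (fun f y hy => ?_) (fun y hy => ?_) ?_
      · exact ((f.contDiffOn_comp_symm x).ftaylorSeriesWithin
          (uniqueDiffOn_extChartAt_target x)).fderivWithin m hm y hy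
      · rw [hp x m (by omega) y hy]
        exact hpt x ⟨m, by omega⟩ ⟨y, hy⟩
      · rw [Metric.tendstoLocallyUniformlyOn_iff] at hu ⊢
        intro ε hε y hy
        obtain ⟨t, ht, h⟩ := hu ε hε y hy
        refine ⟨t, ht, h.mono fun f hf y' hy' => ?_⟩
        have := (continuousMultilinearCurryLeftEquiv ℝ (fun _ : Fin (m + 1) => E) ℝ).dist_map
          (p x y' (m + 1)) (iteratedFDerivWithin ℝ (m + 1)
          (f ∘ (extChartAt I x).symm) (extChartAt I x).target y')
        exact this.trans_lt (hf y' hy')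
    · have hm' : m < k + 1 := Nat.lt_succ_iff.2 (by exact_mod_cast hm)
      rw [continuousOn_iff_continuous_domRestrict]
      exact (P x ⟨m, hm'⟩).continuous.congr fun z => (hp x m hm' z z.2).symm
  have hgC : ContMDiff I 𝓘(ℝ, ℝ) k g := contMDiff_of_contDiffOn_comp_symm fun x =>
    (hT x).contDiffOn (n := (k : ℕ∞))
  refine ⟨⟨g, hgC⟩, ?_⟩
  funext x j
  ext1 z
  rw [← hp x j j.2 z z.2]
  exact ((hT x).eq_iteratedFDerivWithin_of_uniqueDiffOn
    (by exact_mod_cast Nat.lt_succ_iff.1 j.2) (uniqueDiffOn_extChartAt_target x) z.2).symm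

instance CkFun.instCompleteSpace (k : ℕ) : CompleteSpace (CkFun I V k) :=
  (completeSpace_iff_isComplete_range (CkFun.isUniformInducing_jet k)).2
    (CkFun.isClosed_range_jet k).isComplete

instance CkFun.instIsCountablyGenerated [SigmaCompactSpace V] (k : ℕ) :
    (uniformity (CkFun I V k)).IsCountablyGenerated :=
  IsUniformAddGroup.uniformity_countably_generated

instance CkFun.instIsCompletelyMetrizableSpace [SigmaCompactSpace V] (k : ℕ) :
    IsCompletelyMetrizableSpace (CkFun I V k) := by
  let : MetricSpace (CkFun I V k) := UniformSpace.metricSpace _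
  infer_instance

end Frechet

/-! ### Convex series -/

theorem Convex.sum_half_pow_smul_mem {L : Type*} [AddCommGroup L] [Module ℝ L] {W : Set L}
    (hW : Convex ℝ W) (m : ℕ) {y : ℕ → L} (hy : ∀ r, y r ∈ W) {z : L} (hz : z ∈ W) :
    ∑ r ∈ Finset.range m, (1 / 2 : ℝ) ^ (r + 1) • y r + (1 / 2 : ℝ) ^ m • z ∈ W := by
  induction m generalizing z with
  | zero => simpa using hz
  | succ m ih =>
    have h1 : (1 / 2 : ℝ) • y m + (1 / 2 : ℝ) • z ∈ W :=
      hW (hy m) hz (by norm_num) (by norm_num) (by norm_num)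
    convert ih h1 using 1
    rw [Finset.sum_range_succ, pow_succ]
    module

theorem exists_tendsto_sum_half_pow_smul {Q L : Type*} [TopologicalSpace Q] [CompactSpace Q]
    [AddCommGroup L] [Module ℝ L] [UniformSpace L] [IsUniformAddGroup L] [ContinuousSMul ℝ L]
    [CompleteSpace C(Q, L)] {W : ℕ → Set L}
    (hW : (𝓝 (0 : L)).HasAntitoneBasis W) (hWc : ∀ i, Convex ℝ (W i)) {y : ℕ → C(Q, L)}
    (hy : ∀ r q, y r q ∈ W r) :
    ∃ g : C(Q, L), ∀ q, Tendsto (fun m => ∑ r ∈ Finset.range m, (1 / 2 : ℝ) ^ (r + 1) • y r q)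
      atTop (𝓝 (g q)) := by
  have h0 (i) : (0 : L) ∈ W i := mem_of_mem_nhds (hW.mem i)
  have hc : CauchySeq fun m => ∑ r ∈ Finset.range m, (1 / 2 : ℝ) ^ (r + 1) • y r := by
    rw [ContinuousMap.hasBasis_compactConvergenceUniformity_of_compact.cauchySeq_iff']
    intro U hU
    rw [uniformity_eq_comap_nhds_zero_swapped L] at hU
    obtain ⟨T, hT, hTU⟩ := hU
    obtain ⟨N, -, hN⟩ := hW.1.mem_iff.1 hT
    refine ⟨N, fun m hm q => hTU (hN ?_)⟩
    obtain ⟨d, rfl⟩ := Nat.exists_eq_add_of_le hm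
    -- A block of the series starting at N is 2^(-N) times a sum of this form, whose missing weight
    -- 2^(-d) is placed at 0.
    have h1 := (hWc N).sum_half_pow_smul_mem d (y := fun r => y (N + r) q)
      (fun r => hW.2 (Nat.le_add_right N r) (hy (N + r) q)) (h0 N)
    rw [smul_zero, add_zero] at h1
    have h2 := (hWc N).smul_mem_of_zero_mem (h0 N) h1
      (t := (1 / 2 : ℝ) ^ N) ⟨by positivity, pow_le_one₀ (by norm_num) (by norm_num)⟩
    convert h2 using 1
    simp only [ContinuousMap.coe_sum, Finset.sum_apply, ContinuousMap.coe_smul, Pi.smul_apply]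
    rw [Finset.sum_range_add, add_sub_cancel_left, Finset.smul_sum]
    refine Finset.sum_congr rfl fun r _ => ?_
    rw [smul_smul, ← pow_add]
    rfl
  obtain ⟨g, hg⟩ := cauchySeq_tendsto_of_complete hc
  refine ⟨g, fun q => ?_⟩
  have := ((continuous_eval_const q).tendsto g).comp hg
  refine this.congr fun m => ?_
  simp [ContinuousMap.coe_sum]

theorem IsInftyConvex.convex {L : Type*} [AddCommGroup L] [Module ℝ L] [TopologicalSpace L]
    [IsTopologicalAddGroup L] [ContinuousSMul ℝ L] [T2Space L] {C : Set L} (hC : IsInftyConvex C) :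
    Convex ℝ C := by
  intro x hx y hy a b ha hb hab
  let u : ℕ → L := fun i => if i = 0 then x else y
  let t : ℕ → ℝ := fun i => if i = 0 then a else if i = 1 then b else 0
  have ht0 (i : ℕ) (hi : i ∉ Finset.range 2) : t i = 0 := by
    simp only [Finset.mem_range, not_lt] at hi
    simp [t, show i ≠ 0 by omega, show i ≠ 1 by omega]
  have ht : HasSum t 1 := by
    have h := hasSum_sum_of_ne_finset_zero (L := SummationFilter.unconditional ℕ) ht0
    simpa [Finset.sum_range_succ, t, hab] using h
  obtain ⟨z, hz, hlim⟩ := hC u (fun i => by by_cases h : i = 0 <;> simp [u, h, hx, hy])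
    (((Set.toFinite {x, y}).isVonNBounded).subset (by
      rintro _ ⟨i, rfl⟩
      by_cases h : i = 0 <;> simp [u, h])) t
    (fun i => by dsimp only [t]; split_ifs <;> simp [ha, hb]) ht
  have hsum := (hasSum_sum_of_ne_finset_zero (f := fun i => t i • u i) (s := Finset.range 2)
    (L := SummationFilter.unconditional ℕ) (fun i hi => by rw [ht0 i hi, zero_smul])).tendsto_sum_nat
  rw [tendsto_nhds_unique hlim hsum] at hz
  simpa [Finset.sum_range_succ, t, u] using hz

/-! ### Maps at one level of smoothness and their combination -/

section Bullet

variable {E : Type u} [NormedAddCommGroup E] [NormedSpace ℝ E]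
  {H : Type v} [TopologicalSpace H] {I : ModelWithCorners ℝ E H}
  {V : Type w} [TopologicalSpace V] [ChartedSpace H V] [IsManifold I ∞ V]

theorem bulletSet_eq_preimage_incl {l k : ℕ} (h : l ≤ k) (S : Set (CkFun I V l)) :
    bulletSet S k = CkFun.incl h ⁻¹' S := by
  ext g
  refine ⟨?_, fun hg => ⟨_, hg, rfl⟩⟩
  rintro ⟨f, hf, hfg⟩
  have : f = CkFun.incl h g := ContMDiffMap.coe_injective hfg
  rwa [mem_preimage, ← this]

theorem CkFun.exists_convex_antitone_basis [FiniteDimensional ℝ E] [SigmaCompactSpace V] (k : ℕ) :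
    ∃ W : ℕ → Set (CkFun I V k), (𝓝 0).HasAntitoneBasis W ∧ ∀ i, Convex ℝ (W i) := by
  obtain ⟨W, hW, hW'⟩ :=
    (LocallyConvexSpace.convex_basis_zero ℝ (CkFun I V k)).exists_antitone_subbasis
  exact ⟨_, hW', fun i => (hW i).2⟩

theorem exists_continuousMap_contMDiff_iff [FiniteDimensional ℝ E] [SigmaCompactSpace V]
    {l k : ℕ} (hlk : l ≤ k) {S : Set (CkFun I V l)} (hconvex : Convex ℝ S) (hGδ : IsGδ S)
    (hne : (regularPart S k (⊤ : ℕ∞)).Nonempty) (hdense : Dense (regularPart S k (⊤ : ℕ∞)))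
    (hσZ : ∃ Y : Set (bulletSet S k), IsSigmaZSet Y ∧ regularPart S k ((k + 1 : ℕ) : ℕ∞) ⊆ Y)
    (F : ℕ → Set HilbertCube) (hF : ∀ i, IsClosed (F i)) :
    ∃ f : C(HilbertCube, CkFun I V k), (∀ x, CkFun.incl hlk (f x) ∈ S) ∧
      (∀ x ∈ ⋃ i, F i, ContMDiff I 𝓘(ℝ, ℝ) ∞ (f x)) ∧
      ∀ x ∉ ⋃ i, F i, ¬ ContMDiff I 𝓘(ℝ, ℝ) ((k + 1 : ℕ) : ℕ∞) (f x) := by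
  obtain ⟨_, ⟨Z, hZ, rfl⟩, hY⟩ := hσZ
  have hX : IsGδ (bulletSet S k) := by
    rw [bulletSet_eq_preimage_incl hlk]
    exact hGδ.preimage (CkFun.incl hlk).continuous
  have hDc : Convex ℝ (Subtype.val '' regularPart S k (⊤ : ℕ∞)) := by
    rintro _ ⟨⟨f, hf⟩, hf', rfl⟩ _ ⟨⟨g, hg⟩, hg', rfl⟩ a b ha hb hab
    refine ⟨⟨a • f + b • g, ?_⟩, ?_, rfl⟩
    · rw [bulletSet_eq_preimage_incl hlk] at hf hg ⊢
      rw [mem_preimage, map_add, map_smul, map_smul]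
      exact hconvex hf hg ha hb hab
    · exact (contMDiff_const.mul hf').add (contMDiff_const.mul hg')
  obtain ⟨f, hf1, hf2⟩ := exists_continuousMap_of_isZSet hX hne hdense hDc Z hZ F hF
  refine ⟨⟨fun x => f x, by fun_prop⟩, fun x => ?_, fun x hx => hf1 x hx, fun x hx h => ?_⟩
  · exact (bulletSet_eq_preimage_incl hlk S).subset (f x).2
  · obtain ⟨i, hi⟩ := mem_iUnion.1 (hY (show f x ∈ regularPart S k ((k + 1 : ℕ) : ℕ∞) from h))
    exact hf2 x hx i hi

theorem CkFun.exists_smul_mem {Q : Type*} [TopologicalSpace Q] [CompactSpace Q] {k : ℕ}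
    (u : C(Q, CkFun I V k)) {N : Set (CkFun I V k)} (hN : N ∈ 𝓝 0) :
    ∃ s : ℝ, 0 < s ∧ s ≤ 1 ∧ ∀ x, s • u x ∈ N := by
  have hb : Bornology.IsVonNBounded ℝ (range u) := (isCompact_range u.continuous).isVonNBounded ℝ
  have h1 : ∀ᶠ s : ℝ in 𝓝[>] 0, s • range u ⊆ N :=
    (tendsto_smallSets_iff.1 hb.tendsto_smallSets_nhds N hN).filter_mono nhdsWithin_le_nhds
  have h2 : ∀ᶠ s : ℝ in 𝓝[>] 0, s ≤ 1 :=
    (eventually_le_nhds one_pos).filter_mono nhdsWithin_le_nhds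
  obtain ⟨s, hs1, hs2, hs3⟩ := (h1.and (h2.and self_mem_nhdsWithin)).exists
  exact ⟨s, hs3, hs2, fun x => hs1 (smul_mem_smul_set (mem_range_self x))⟩

theorem exists_continuousMap_preimage_eq_iInter [FiniteDimensional ℝ E] [SigmaCompactSpace V]
    {l n : ℕ} (hln : l ≤ n) {S : Set (CkFun I V l)} (hconvex : IsInftyConvex S)
    {a : V → ℝ} (ha : ContMDiff I 𝓘(ℝ, ℝ) ∞ a) (haS : ∃ f ∈ S, (f : V → ℝ) = a)
    (M : ℕ → Set HilbertCube) (φ : (i : ℕ) → C(HilbertCube, CkFun I V (n + i)))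
    (hφS : ∀ i x, CkFun.incl (hln.trans (Nat.le_add_right n i)) (φ i x) ∈ S)
    (hφM : ∀ i, ∀ x ∈ M i, ContMDiff I 𝓘(ℝ, ℝ) ∞ (φ i x))
    (hφM' : ∀ i, ∀ x ∉ M i, ¬ ContMDiff I 𝓘(ℝ, ℝ) ((n + i + 1 : ℕ) : ℕ∞) (φ i x)) :
    ∃ f : C(HilbertCube, CkFun I V n), (∀ x, CkFun.incl hln (f x) ∈ S) ∧
      ∀ x, ContMDiff I 𝓘(ℝ, ℝ) ∞ (f x) ↔ ∀ i, x ∈ M i := by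
  let a' (k : ℕ) : CkFun I V k := ⟨a, ha.of_le (by exact_mod_cast le_top)⟩
  have ha'S : a' l ∈ S := by
    obtain ⟨f, hf, hfa⟩ := haS
    have : f = a' l := ContMDiffMap.coe_injective hfa
    rwa [← this]
  choose W hW hWc using fun k : ℕ => CkFun.exists_convex_antitone_basis (I := I) (V := V) k
  let u (i : ℕ) : C(HilbertCube, CkFun I V (n + i)) :=
    ⟨fun x => φ i x - a' (n + i), by fun_prop⟩
  -- The i-th term is made small in every C^j with j ≤ n + i at once, so that each tail converges in
  -- its own C^j.
  have hnhds (i : ℕ) : (⋂ j : Fin (n + i + 1), CkFun.incl (Nat.lt_succ_iff.1 j.2) ⁻¹' W j i) ∈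
      𝓝 (0 : CkFun I V (n + i)) := by
    refine iInter_mem.2 fun j => (CkFun.incl (Nat.lt_succ_iff.1 j.2)).continuous.continuousAt ?_
    rw [map_zero]
    exact (hW j).mem i
  choose s hs0 hs1 hsW using fun i => CkFun.exists_smul_mem (u i) (hnhds i)
  let v (i : ℕ) : C(HilbertCube, CkFun I V (n + i)) := ⟨fun x => s i • u i x, by fun_prop⟩
  have hvW (i j : ℕ) (hj : j ≤ n + i) (x) : CkFun.incl hj (v i x) ∈ W j i :=
    mem_iInter.1 (hsW i x) ⟨j, Nat.lt_succ_iff.2 hj⟩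
  have hvφ (i x p) : v i x p = s i * (φ i x p - a p) := rfl
  have htail (i : ℕ) := exists_tendsto_sum_half_pow_smul (hW (n + i)) (hWc (n + i))
    (y := fun r => ⟨fun x => CkFun.incl (show n + i ≤ n + (i + r) by omega) (v (i + r) x),
      by fun_prop⟩) (fun r x => (hW (n + i)).2 (Nat.le_add_left r i) (hvW (i + r) _ (by omega) x))
  choose T hT using htail
  have hTp (i x p) : Tendsto (fun m => ∑ r ∈ Finset.range m, (1 / 2 : ℝ) ^ (r + 1) * v (i + r) x p)
      atTop (𝓝 (T i x p)) := by
    have := ((CkFun.continuous_eval (n + i) p).tendsto _).comp (hT i x)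
    refine this.congr fun m => ?_
    induction m with
    | zero => simp
    | succ m ih =>
      simp only [Function.comp_apply, Finset.sum_range_succ] at ih ⊢
      rw [ContMDiffMap.coe_add, Pi.add_apply, ih]
      rfl
  have hsplit (i x p) : T 0 x p = ∑ r ∈ Finset.range i, (1 / 2 : ℝ) ^ (r + 1) * v r x p +
      (1 / 2 : ℝ) ^ i * T i x p := by
    have h1 := (hTp 0 x p).comp (tendsto_add_atTop_nat i)
    have h2 := ((hTp i x p).const_mul ((1 / 2 : ℝ) ^ i)).const_add
      (∑ r ∈ Finset.range i, (1 / 2 : ℝ) ^ (r + 1) * v r x p)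
    refine tendsto_nhds_unique h1 (h2.congr fun m => ?_)
    have hz (r : ℕ) : v (0 + r) x p = v r x p := by
      rw [hvφ, hvφ, Nat.zero_add]
    simp only [Function.comp_apply, hz]
    rw [add_comm m i, Finset.sum_range_add, Finset.mul_sum]
    congr 1
    refine Finset.sum_congr rfl fun r _ => ?_
    rw [← mul_assoc, ← pow_add]
    rfl
  let f : C(HilbertCube, CkFun I V n) :=
    ⟨fun x => a' n + CkFun.incl (Nat.le_add_right n 0) (T 0 x), by fun_prop⟩
  have hf (x p) : f x p = a p + T 0 x p := rfl
  have hvM (i : ℕ) (x) (hx : x ∈ M i) : ContMDiff I 𝓘(ℝ, ℝ) ∞ (v i x) :=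
    contMDiff_const.mul ((hφM i x hx).sub ha)
  have hsum (i : ℕ) (x) (hx : ∀ r < i, x ∈ M r) : ContMDiff I 𝓘(ℝ, ℝ) ∞
      fun p => ∑ r ∈ Finset.range i, (1 / 2 : ℝ) ^ (r + 1) * v r x p :=
    contMDiff_finsetSum fun r hr =>
      contMDiff_const.mul (hvM r x (hx r (Finset.mem_range.1 hr)))
  refine ⟨f, fun x => ?_, fun x => ⟨fun h => ?_, fun h => ?_⟩⟩
  · let z (r : ℕ) : CkFun I V l := a' l + CkFun.incl (hln.trans (Nat.le_add_right n r)) (v r x)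
    have hzS (r : ℕ) : z r ∈ S := by
      have := hconvex.convex ha'S (hφS r x) (sub_nonneg.2 (hs1 r)) (hs0 r).le (by ring)
      convert this using 1
      ext p
      change a p + s r * (φ r x p - a p) = (1 - s r) * a p + s r * φ r x p
      ring
    have hgeom : HasSum (fun r : ℕ => (1 / 2 : ℝ) ^ (r + 1)) 1 := by
      convert hasSum_geometric_two' 1 using 2 with r
      rw [pow_succ, one_div_pow]
      ring
    -- Convergence to a supplies the boundedness that ∞-convexity requires.
    have hz0 : Tendsto z atTop (𝓝 (a' l + 0)) := by
      refine tendsto_const_nhds.add ((hW l).1.tendsto_right_iff.2 fun i _ => ?_)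
      filter_upwards [eventually_ge_atTop i] with r hr
      exact (hW l).2 hr (hvW r l _ x)
    obtain ⟨y, hyS, hy⟩ := hconvex z hzS (hz0.isVonNBounded_range ℝ) (fun r => (1 / 2) ^ (r + 1))
      (fun r => by positivity) hgeom
    suffices h : CkFun.incl hln (f x) = y by rwa [h]
    ext p
    have h1 := ((CkFun.continuous_eval l p).tendsto _).comp hy
    have h2 : Tendsto (fun m => (∑ r ∈ Finset.range m, (1 / 2 : ℝ) ^ (r + 1)) * a p +
        ∑ r ∈ Finset.range m, (1 / 2 : ℝ) ^ (r + 1) * v (0 + r) x p) atTop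
        (𝓝 (1 * a p + T 0 x p)) := by
      refine Tendsto.add (Tendsto.mul_const _ ?_) (hTp 0 x p)
      exact hgeom.tendsto_sum_nat
    rw [CkFun.coe_incl, hf, ← one_mul (a p)]
    refine tendsto_nhds_unique h2 (h1.congr fun m => ?_)
    induction m with
    | zero => simp
    | succ m ih =>
      simp only [Function.comp_apply, Finset.sum_range_succ] at ih ⊢
      rw [ContMDiffMap.coe_add, Pi.add_apply, ih, hvφ, Nat.zero_add]
      change _ + (1 / 2 : ℝ) ^ (m + 1) * (a p + s m * (φ m x p - a p)) = _
      ring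
  · by_contra! hx
    classical
    have hM := Nat.find_spec hx
    set i := Nat.find hx
    have hlt (r : ℕ) (hr : r < i) : x ∈ M r := by
      by_contra h
      exact Nat.find_min hx hr h
    refine hφM' i x hM ?_
    have hle : (((n + i + 1 : ℕ) : ℕ∞) : WithTop ℕ∞) ≤ ∞ := by exact_mod_cast le_top
    -- Solving the series for its i-th term expresses φ_i(x) through f(x), the smooth earlier terms
    -- and a C^(n+i+1) tail.
    have h1 : ContMDiff I 𝓘(ℝ, ℝ) ((n + i + 1 : ℕ) : ℕ∞) (fun p => a p + (s i)⁻¹ * (2 ^ (i + 1) *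
        (f x p - a p - ∑ r ∈ Finset.range i, (1 / 2 : ℝ) ^ (r + 1) * v r x p -
        (1 / 2 : ℝ) ^ (i + 1) * T (i + 1) x p))) :=
      (ha.of_le hle).add (contMDiff_const.mul (contMDiff_const.mul
        ((((h.of_le hle).sub (ha.of_le hle)).sub ((hsum i x hlt).of_le hle)).sub
        (contMDiff_const.mul (T (i + 1) x).contMDiff))))
    convert h1 using 1
    funext p
    have h2 := hsplit (i + 1) x p
    rw [Finset.sum_range_succ, hvφ i] at h2
    have := (hs0 i).ne'
    rw [hf, h2]
    have h3 : (2 : ℝ) ^ (i + 1) * (1 / 2) ^ (i + 1) = 1 := by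
      rw [← mul_pow]; norm_num
    have h4 : a p + (s i)⁻¹ * (((2 : ℝ) ^ (i + 1) * (1 / 2) ^ (i + 1)) *
        (s i * (φ i x p - a p))) = φ i x p := by
      rw [h3, one_mul, inv_mul_cancel_left₀ this]; ring
    refine h4.symm.trans ?_
    ring
  · rw [contMDiff_infty]
    intro i
    have hle : ((n + i : ℕ) : WithTop ℕ∞) ≤ ∞ := by exact_mod_cast le_top
    have h1 : ContMDiff I 𝓘(ℝ, ℝ) ((n + i : ℕ) : WithTop ℕ∞) (fun p => a p +
        (∑ r ∈ Finset.range i, (1 / 2 : ℝ) ^ (r + 1) * v r x p + (1 / 2 : ℝ) ^ i * T i x p)) :=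
      (ha.of_le hle).add (((hsum i x fun r _ => h r).of_le hle).add
        (contMDiff_const.mul (T i x).contMDiff))
    have h2 : (f x : V → ℝ) = _ := funext fun p => (hf x p).trans (by rw [hsplit i])
    rw [h2]
    exact h1.of_le (by exact_mod_cast Nat.le_add_left i n)

end Bullet

theorem mainTheorem9 {E : Type u} [NormedAddCommGroup E] [NormedSpace ℝ E]
    [FiniteDimensional ℝ E] {H : Type v} [TopologicalSpace H] (I : ModelWithCorners ℝ E H)
    (V : Type w) [TopologicalSpace V] [ChartedSpace H V] [IsManifold I ∞ V]
    [T2Space V] [SigmaCompactSpace V]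
    (l : ℕ) (S : Set (CkFun I V l)) (hconvex : IsInftyConvex S) (hGδ : IsGδ S)
    (n : ℕ) (hln : l ≤ n) (hne : (regularPart S n (⊤ : ℕ∞)).Nonempty)
    (hdense : ∀ k : ℕ, n ≤ k → Dense (regularPart S k (⊤ : ℕ∞)))
    (hσZ : ∀ k : ℕ, n ≤ k →
      ∃ Y : Set (bulletSet S k), IsSigmaZSet Y ∧ regularPart S k ((k + 1 : ℕ) : ℕ∞) ⊆ Y) :
    IsM0M2Preuniversal.{_, u₀} (bulletSet S n) (regularPart S n (⊤ : ℕ∞)) := by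
  intro K _ _ _ M ⟨F, hF, hM⟩
  obtain ⟨⟨a, haS⟩, ha⟩ := hne
  replace ha : ContMDiff I 𝓘(ℝ, ℝ) ∞ a := ha
  let := metrizableSpaceMetric K
  obtain ⟨e, he⟩ := Metric.PiNatEmbed.exists_embedding_to_hilbert_cube (X := K)
  have hec : Topology.IsClosedEmbedding e := he.continuous.isClosedEmbedding he.injective
  have hlev (i : ℕ) := exists_continuousMap_contMDiff_iff (hln.trans (Nat.le_add_right n i))
    hconvex.convex hGδ
    ⟨⟨⟨a, ha.of_le (by exact_mod_cast le_top)⟩, haS⟩, ha⟩ (hdense (n + i) (Nat.le_add_right n i))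
    (hσZ (n + i) (Nat.le_add_right n i)) (fun j => e '' F i j)
    (fun j => hec.isClosedMap _ (hF i j))
  choose φ hφS hφM hφM' using hlev
  obtain ⟨f, hfS, hf⟩ := exists_continuousMap_preimage_eq_iInter hln hconvex ha haS
    (fun i => ⋃ j, e '' F i j) φ hφS hφM hφM'
  refine ⟨⟨fun x => ⟨f (e x), _, hfS (e x), rfl⟩,
    (f.continuous.comp he.continuous).subtype_mk _⟩, ?_⟩
  ext x
  change ContMDiff I 𝓘(ℝ, ℝ) ∞ (f (e x)) ↔ x ∈ M
  rw [hf, hM]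
  simp [he.injective.eq_iff]
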